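/- **Setting.** Let $\Sigma=CS\uplus FS$ be a first-order signature of constructor and function symbols with arities, with a distinguished $?\in FS^2$ (written infix), and let $\mathcal V$ be a set of variables. Total expressions ($\mathit{Exp}$) are the terms over $\Sigma$ and $\mathcal V$; partial expressions ($\mathit{Exp}_\bot$) may also contain the constant $\bot$. Total and partial c-terms ($\mathit{CTerm}$, $\mathit{CTerm}_\bot$) are those without function symbols. On $\mathit{Exp}_\bot$, $\sqsubseteq$ is the least partial order with $\bot\sqsubseteq e$ and $e\sqsubseteq e'\Rightarrow C[e]\sqsubseteq C[e']$ for all one-hole contexts $C$. The shell of $e$ is given by $|X|=X$, $|c(e_1,\dots,e_n)|=c(|e_1|,\dots,|e_n|)$ for $c\in CS$, $|f(\dots)|=\bot$ for $f\in FS$, $|\bot|=\bot$. A program $\mathcal P$ is a (possibly infinite) set of rules $f(p_1,\dots,p_n)\to r$ with $f\in FS^n$, $p_i\in \mathit{CTerm}$, no variable occurring twice in $(p_1,\dots,p_n)$, and $r\in \mathit{Exp}$ (which may contain extra variables, i.e. variables not in the left-hand side). For two distinct variables $X,Y$ it contains $X\,?\,Y\to X$ and $X\,?\,Y\to Y$,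 and it has no other rule for $?$. Rewriting is $C[l\sigma]\to C[r\sigma]$ for a context $C$ over $\mathit{Exp}$, $(l\to r)\in\mathcal P$ and a substitution $\sigma:\mathcal V\to \mathit{Exp}$ of finite domain; $\to^*$ is its reflexive-transitive closure. An s-expression is a finite set of elemental s-expressions; an elemental s-expression is a variable or $h(se_1,\dots,se_n)$ with $h\in\Sigma^n$ and s-expressions $se_i$. S-cterms are the s-expressions without function symbols. An s-csubstitution $\theta$ maps variables to s-cterms, with $\theta(X)=\{X\}$ for all but finitely many $X$; it acts by $X\theta=\theta(X)$, $h(se_1,\dots,se_n)\theta=\{h(se_1\theta,\dots,se_n\theta)\}$, $se\,\theta=\bigcup_{a\in se}a\theta$. For $e\in \mathit{Exp}_\bot$ define $\widetilde{\bot}=\emptyset$, $\widetilde X=\{X\}$, $\widetilde{h(e_1,\dots,e_n)}=\{h(\widetilde{e_1},\dots,\widetilde{e_n})\}$. Flattening is $\mathit{flat}(\emptyset)=\{\bot\}$, $\mathit{flat}(se)=\bigcup_{a\in se}\mathit{flat}(a)$ for $se\neq\emptyset$, $\mathit{flat}(X)=\{X\}$, $\mathit{flat}(h(se_1,\dots,se_n))=\{h(e_1,\dots,e_n)\mid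 e_i\in \mathit{flat}(se_i)\}$. The relation $se\rightarrowtail st$ is inductively generated by the rules: - (E) $se\rightarrowtail\emptyset$; - (RR) $\{X\}\rightarrowtail\{X\}$ for $X\in\mathcal V$; - (DC) $\{c(se_1,\dots,se_n)\}\rightarrowtail\{c(st_1,\dots,st_n)\}$ if $c\in CS$ and $se_i\rightarrowtail st_i$ for all $i$; - (More) $se\rightarrowtail st_1\cup\dots\cup st_n$ if $se\rightarrowtail st_i$ for all $i$; - (Less) $se\rightarrowtail st_1\cup\dots\cup st_m$ if $se$ has at least two elements, $m>0$, and there are $a_1,\dots,a_m\in se$ with $\{a_j\}\rightarrowtail st_j$ for all $j$; - (ROR) $\{f(se_1,\dots,se_n)\}\rightarrowtail st$ if, for some rule $(f(p_1,\dots,p_n)\to r)\in\mathcal P$ and some s-csubstitution $\theta$, $se_i\rightarrowtail\widetilde{p_i}\,\theta$ for all $i$ and $\widetilde r\,\theta\rightarrowtail st$. The denotation of $se$ is $[\![se]\!]=\{st\text{ an s-cterm}\mid se\rightarrowtail st\}$. **Theorem (Adequacy of $[\![\_]\!]$).** For every program, all $e,e'\in \mathit{Exp}$, $t\in \mathit{CTerm}_\bot$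 and every s-cterm $st$: *Soundness.* (a) If $st\in[\![\widetilde e]\!]$ and $t\in \mathit{flat}(st)$, then $e\to^* e''$ for some $e''\in \mathit{Exp}$ with $t\sqsubseteq|e''|$. (b) If $\widetilde t\in[\![\widetilde e]\!]$, then $e\to^* e''$ for some $e''\in \mathit{Exp}$ with $t\sqsubseteq|e''|$. (c) In either case, if $t$ is total then $e\to^* t$. *Completeness.* (d) If $e\to^* e'$, then $\widetilde{|e'|}\in[\![\widetilde e]\!]$. (e) If $t$ is total and $e\to^* t$, then $\widetilde t\in[\![\widetilde e]\!]$. -/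

import Mathlib

universe u

noncomputable section

namespace SCalc

/-- A first-order signature `Σ = CS ⊎ FS`, sorted by arity, with the distinguished binary
function symbol `?`. -/
structure Signature where
  /-- constructor symbols of each arity -/
  Con : ℕ → Type u
  /-- defined function symbols of each arity -/
  Fun : ℕ → Type u
  /-- the binary function symbol `?` -/
  choice : Fun 2

/-- The symbols of arity `n`: constructors on the left, function symbols on the right. -/
abbrev Signature.Sym (S : Signature.{u}) (n : ℕ) : Type u := S.Con n ⊕ S.Fun n

/-! ### Expressions -/

/-- Partial expressions over the variables `V`. -/
inductive PExp (S : Signature.{u}) (V : Type u) : Type u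
  | bot : PExp S V
  | var (X : V) : PExp S V
  | app {n : ℕ} (h : S.Sym n) (args : Fin n → PExp S V) : PExp S V

variable {S : Signature.{u}} {V : Type u}

namespace PExp

/-- The partial expressions without `⊥`, that is, the set of (total) expressions. -/
def IsTotal : PExp S V → Prop
  | bot => False
  | var _ => True
  | app _ args => ∀ i, IsTotal (args i)

/-- The partial expressions without function symbols, that is, the set of partial c-terms.
A total c-term is a partial c-term that is total. -/
def IsCTerm : PExp S V → Prop
  | bot => True
  | var _ => True
  | app (.inl _) args => ∀ i, IsCTerm (args i)
  | app (.inr _) _ => False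

/-- The shell `|e|`: the outer constructed part of `e`. -/
def shell : PExp S V → PExp S V
  | bot => bot
  | var X => var X
  | app (.inl c) args => app (.inl c) fun i => shell (args i)
  | app (.inr _) _ => bot

open Classical in
/-- The number of occurrences of the variable `X` in an expression. -/
def occ (X : V) : PExp S V → ℕ
  | bot => 0
  | var Y => if X = Y then 1 else 0
  | app _ args => ∑ i, occ X (args i)

/-- Application of a mapping from variables to expressions. -/
def subst (σ : V → PExp S V) : PExp S V → PExp S V
  | bot => bot
  | var X => σ X
  | app h args => app h fun i => subst σ (args i)

end PExp

/-- One-hole contexts `C ::= [ ] | h(e₁, …, C, …, eₙ)`. In `app h i es C` the context `C` is the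
`i`-th argument of `h`, and `es j` is the `j`-th one for `j ≠ i` (the value `es i` is ignored). -/
inductive Ctx (S : Signature.{u}) (V : Type u) : Type u
  | hole : Ctx S V
  | app {n : ℕ} (h : S.Sym n) (i : Fin n) (es : Fin n → PExp S V) (C : Ctx S V) : Ctx S V

/-- `C[e]`. -/
def Ctx.fill : Ctx S V → PExp S V → PExp S V
  | hole, e => e
  | app h i es C, e => .app h (Function.update es i (C.fill e))

/-- The contexts in which `⊥` does not occur. -/
def Ctx.IsTotal : Ctx S V → Prop
  | hole => True
  | app _ i es C => (∀ j, j ≠ i → (es j).IsTotal) ∧ C.IsTotal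

/-- The approximation ordering on partial expressions: the least reflexive and transitive relation
with `⊥ ⊑ e` that is closed under contexts. It is antisymmetric (`Approx.antisymm`), so it is also the least
partial order with these properties. -/
inductive Approx : PExp S V → PExp S V → Prop
  | refl (e : PExp S V) : Approx e e
  | trans {e₁ e₂ e₃ : PExp S V} : Approx e₁ e₂ → Approx e₂ e₃ → Approx e₁ e₃
  | bot (e : PExp S V) : Approx .bot e
  | ctx {e e' : PExp S V} (C : Ctx S V) : Approx e e' → Approx (C.fill e) (C.fill e')

/-- The number of nodes other than `⊥`, used only to see that `⊑` is antisymmetric. -/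
def PExp.weight : PExp S V → ℕ
  | bot => 0
  | var _ => 1
  | app _ args => 1 + ∑ i, weight (args i)

theorem Approx.weight_le {a b : PExp S V} (h : Approx a b) :
    a.weight ≤ b.weight ∧ (a.weight = b.weight → a = b) := by
  induction h with
  | refl e => exact ⟨le_rfl, fun _ => rfl⟩
  | trans _ _ ih₁ ih₂ =>
    refine ⟨ih₁.1.trans ih₂.1, fun h => ?_⟩
    have h₁ := ih₁.1
    have h₂ := ih₂.1
    exact (ih₁.2 (by omega)).trans (ih₂.2 (by omega))
  | bot e =>
    refine ⟨Nat.zero_le _, fun h => ?_⟩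
    cases e with
    | bot => rfl
    | var X => simp [PExp.weight] at h
    | app f args => simp only [PExp.weight] at h; omega
  | @ctx e e' C _ ih =>
    induction C with
    | hole => exact ih
    | app f i es C ihC =>
      have key : ∀ x : PExp S V, (PExp.app f (Function.update es i x)).weight =
          1 + (x.weight + ∑ j ∈ Finset.univ \ {i}, (es j).weight) := by
        intro x
        have h := Finset.sum_update_of_mem (Finset.mem_univ i) (fun j => (es j).weight) x.weight
        rw [← h]
        simp only [PExp.weight]
        congr 1
        refine Finset.sum_congr rfl fun j _ => ?_
        by_cases hj : j = i
        · subst hj; simp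
        · simp [hj]
      simp only [Ctx.fill, key]
      have h₁ := ihC.1
      refine ⟨by omega, fun h => ?_⟩
      rw [ihC.2 (by omega)]

theorem Approx.antisymm {a b : PExp S V} (h₁ : Approx a b) (h₂ : Approx b a) : a = b :=
  h₁.weight_le.2 (le_antisymm h₁.weight_le.1 h₂.weight_le.1)

/-- Substitutions: finite mappings from variables to total expressions. -/
structure Subst (S : Signature.{u}) (V : Type u) where
  toFun : V → PExp S V
  total : ∀ X, (toFun X).IsTotal
  finite_dom : {X | toFun X ≠ .var X}.Finite

/-! ### Programs and term rewriting -/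

/-- A rewrite rule `f(p₁, …, pₙ) → r`. -/
structure Rule (S : Signature.{u}) (V : Type u) where
  arity : ℕ
  head : S.Fun arity
  pats : Fin arity → PExp S V
  rhs : PExp S V

/-- The left-hand side of a rule. -/
def Rule.lhs (R : Rule S V) : PExp S V := .app (.inr R.head) R.pats

/-- `R` is a left-linear constructor-based rule: its patterns are total c-terms, no variable has
two occurrences in the tuple of patterns, and its right-hand side is a total expression, which may
contain extra variables. -/
structure Rule.IsCRule (R : Rule S V) : Prop where
  pats_cterm : ∀ i, (R.pats i).IsCTerm
  pats_total : ∀ i, (R.pats i).IsTotal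
  linear : ∀ X, ∑ i, (R.pats i).occ X ≤ 1
  rhs_total : R.rhs.IsTotal

/-- The rule `X ? Y → Z`. -/
def choiceRule (X Y Z : V) : Rule S V where
  arity := 2
  head := S.choice
  pats := ![.var X, .var Y]
  rhs := .var Z

/-- Programs: (possibly infinite) sets of left-linear constructor-based rules that contain
`X ? Y → X` and `X ? Y → Y` and no other rule for `?`. -/
structure Program (S : Signature.{u}) (V : Type u) where
  rules : Set (Rule S V)
  isCRule : ∀ R ∈ rules, R.IsCRule
  choice_rules : ∃ X Y : V, X ≠ Y ∧
    {R ∈ rules | (⟨R.arity, R.head⟩ : Σ n, S.Fun n) = ⟨2, S.choice⟩} =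
      {choiceRule X Y X, choiceRule X Y Y}

/-- One rewriting step `C[lσ] → C[rσ]`. -/
def Step (P : Program S V) (e e' : PExp S V) : Prop :=
  ∃ (C : Ctx S V) (R : Rule S V) (σ : Subst S V), C.IsTotal ∧ R ∈ P.rules ∧
    e = C.fill (R.lhs.subst σ.toFun) ∧ e' = C.fill (R.rhs.subst σ.toFun)

/-- The reflexive and transitive closure of the rewriting relation. -/
def Rewrites (P : Program S V) : PExp S V → PExp S V → Prop :=
  Relation.ReflTransGen (Step P)

/-! ### S-expressions

Elemental s-expressions are `X` or `h(se₁, …, seₙ)` with finite sets `seᵢ` of elemental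
s-expressions, so they form the initial algebra of `α ↦ V + Σ n, Symₙ × (Finset α)ⁿ`. -/

/-- The shapes of elemental s-expressions whose arguments are finite sets of elements of `α`. -/
def Shape (S : Signature.{u}) (V : Type u) (α : Type u) : Type u :=
  V ⊕ Σ n : ℕ, S.Sym n × (Fin n → Finset α)

open Classical in
instance : Functor (Shape S V) where
  map f
    | .inl X => .inl X
    | .inr ⟨n, h, args⟩ => .inr ⟨n, h, fun i => (args i).image f⟩

open Classical in
/-- A finite set is represented by an enumeration of its elements. -/
instance : QPF (Shape S V) where
  P :=
    { A := V ⊕ Σ n : ℕ, S.Sym n × (Fin n → ℕ)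
      B := fun
        | .inl _ => ULift.{u} Empty
        | .inr ⟨n, _, k⟩ => ULift.{u} (Σ i : Fin n, Fin (k i)) }
  abs
    | ⟨.inl X, _⟩ => .inl X
    | ⟨.inr ⟨n, h, _⟩, f⟩ =>
      .inr ⟨n, h, fun i => Finset.univ.image fun j => f (ULift.up ⟨i, j⟩)⟩
  repr
    | .inl X => ⟨.inl X, fun x => x.down.elim⟩
    | .inr ⟨n, h, args⟩ =>
      ⟨.inr ⟨n, h, fun i => (args i).card⟩,
        fun x => ((args x.down.1).equivFin.symm x.down.2 : _)⟩
  abs_repr := by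
    rintro α (X | ⟨n, h, args⟩)
    · rfl
    · refine congrArg Sum.inr ?_
      refine Sigma.ext rfl (heq_of_eq (Prod.ext rfl ?_))
      funext i
      ext a
      simp only [Finset.mem_image, Finset.mem_univ, true_and]
      constructor
      · rintro ⟨j, rfl⟩
        exact ((args i).equivFin.symm j).2
      · intro ha
        exact ⟨(args i).equivFin ⟨a, ha⟩, by simp⟩
  abs_map := by
    rintro α β f ⟨X | ⟨n, h, k⟩, g⟩
    · rfl
    · refine congrArg Sum.inr ?_
      refine Sigma.ext rfl (heq_of_eq (Prod.ext rfl ?_))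
      funext i
      ext a
      simp

/-- Elemental s-expressions. -/
def ESExp (S : Signature.{u}) (V : Type u) : Type u := QPF.Fix (Shape S V)

/-- S-expressions: finite sets of elemental s-expressions. -/
abbrev SExp (S : Signature.{u}) (V : Type u) : Type u := Finset (ESExp S V)

instance : DecidableEq (ESExp S V) := Classical.decEq _

namespace ESExp

/-- The elemental s-expression `X`. -/
def var (X : V) : ESExp S V := QPF.Fix.mk (F := Shape S V) (.inl X)

/-- The elemental s-expression `h(se₁, …, seₙ)`. -/
def app {n : ℕ} (h : S.Sym n) (args : Fin n → SExp S V) : ESExp S V :=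
  QPF.Fix.mk (F := Shape S V) (.inr ⟨n, h, args⟩)

/-- Structural recursion on elemental s-expressions. -/
def fold {α : Type u} (v : V → α) (a : ∀ n : ℕ, S.Sym n → (Fin n → Finset α) → α) :
    ESExp S V → α :=
  QPF.Fix.rec (F := Shape S V) fun
    | .inl X => v X
    | .inr ⟨n, h, args⟩ => a n h args

theorem fold_var {α : Type u} (v : V → α) (a : ∀ n : ℕ, S.Sym n → (Fin n → Finset α) → α) (X : V) :
    fold v a (var X) = v X :=
  QPF.Fix.rec_eq (F := Shape S V) _ _

open Classical in
theorem fold_app {α : Type u} (v : V → α) (a : ∀ n : ℕ, S.Sym n → (Fin n → Finset α) → α)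
    {n : ℕ} (h : S.Sym n) (args : Fin n → SExp S V) :
    fold v a (app h args) = a n h fun i => (args i).image (fold v a) :=
  QPF.Fix.rec_eq (F := Shape S V) _ _

theorem mk_injective : Function.Injective (QPF.Fix.mk (F := Shape S V)) := fun x y h =>
  (QPF.Fix.dest_mk x).symm.trans ((congrArg QPF.Fix.dest h).trans (QPF.Fix.dest_mk y))

theorem var_injective : Function.Injective (var : V → ESExp S V) := fun _ _ h =>
  Sum.inl.inj (mk_injective h)

theorem app_inj {n : ℕ} {h h' : S.Sym n} {args args' : Fin n → SExp S V}
    (H : app h args = app h' args') : h = h' ∧ args = args' :=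
  Prod.mk.inj (eq_of_heq (Sigma.mk.inj (Sum.inr.inj (mk_injective H))).2)

theorem app_inj_arity {n m : ℕ} {h : S.Sym n} {h' : S.Sym m} {args : Fin n → SExp S V}
    {args' : Fin m → SExp S V} (H : app h args = app h' args') : n = m :=
  congrArg Sigma.fst (Sum.inr.inj (mk_injective H))

theorem var_ne_app (X : V) {n : ℕ} (h : S.Sym n) (args : Fin n → SExp S V) :
    var X ≠ app h args := fun H =>
  Sum.inl_ne_inr (mk_injective H)

open Classical in
theorem induction {p : ESExp S V → Prop} (hvar : ∀ X, p (var X))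
    (happ : ∀ {n : ℕ} (h : S.Sym n) (args : Fin n → SExp S V),
      (∀ i, ∀ e ∈ args i, p e) → p (app h args)) (e : ESExp S V) : p e := by
  refine QPF.Fix.ind (F := Shape S V) p ?_ e
  rintro (X | ⟨n, h, args⟩) hx
  · exact hvar X
  · refine happ h args fun i e he => ?_
    obtain ⟨u, hu⟩ := hx
    rcases u with X | ⟨m, h', args'⟩
    · exact absurd hu Sum.inl_ne_inr
    · have h1 := Sum.inr.inj hu
      obtain rfl : m = n := congrArg Sigma.fst h1
      have h2 := congrArg Prod.snd (eq_of_heq (Sigma.mk.inj h1).2)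
      have h3 : (args' i).image Subtype.val = args i := congrFun h2 i
      have he' : e ∈ (args' i).image Subtype.val := h3 ▸ he
      obtain ⟨y, -, rfl⟩ := Finset.mem_image.1 he'
      exact y.2

/-- The elemental s-cterms: no function symbol occurs. -/
inductive IsESCTerm : ESExp S V → Prop
  | var (X : V) : IsESCTerm (var X)
  | con {n : ℕ} (c : S.Con n) (args : Fin n → SExp S V) :
      (∀ i, ∀ e ∈ args i, IsESCTerm e) → IsESCTerm (app (.inl c) args)

/-- Application of a mapping from variables to s-expressions:
`Xσ = σ(X)` and `h(se₁, …, seₙ)σ = {h(se₁σ, …, seₙσ)}`. -/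
def subst (σ : V → SExp S V) : ESExp S V → SExp S V :=
  fold σ fun _ h args => {app h fun i => (args i).biUnion id}

end ESExp

namespace SExp

/-- The s-cterms: finite sets of elemental s-cterms. -/
def IsSCTerm (st : SExp S V) : Prop := ∀ e ∈ st, ESExp.IsESCTerm e

/-- `se σ` is the union of the `ese σ` with `ese ∈ se`. -/
def subst (σ : V → SExp S V) (se : SExp S V) : SExp S V := se.biUnion (ESExp.subst σ)

end SExp

theorem ESExp.subst_var (σ : V → SExp S V) (X : V) : ESExp.subst σ (ESExp.var X) = σ X :=
  ESExp.fold_var _ _ X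

theorem ESExp.subst_app (σ : V → SExp S V) {n : ℕ} (h : S.Sym n) (args : Fin n → SExp S V) :
    ESExp.subst σ (ESExp.app h args) = {ESExp.app h fun i => SExp.subst σ (args i)} := by
  refine (ESExp.fold_app _ _ h args).trans ?_
  refine congrArg (fun x => ({ESExp.app h x} : SExp S V)) (funext fun i => ?_)
  ext a
  simp [SExp.subst, ESExp.subst]

/-- The s-expression of a partial expression. -/
def PExp.toSExp : PExp S V → SExp S V
  | bot => ∅
  | var X => {ESExp.var X}
  | app h args => {ESExp.app h fun i => toSExp (args i)}

/-- `flat(se)` for a finite set `se` whose elements have the flattenings in `F`: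
`flat(∅) = {⊥}`, and otherwise the union of the flattenings of the elements. -/
def flatUnion (F : Set (Set (PExp S V))) : Set (PExp S V) :=
  {e | (F = ∅ ∧ e = .bot) ∨ ∃ A ∈ F, e ∈ A}

/-- Flattening of elemental s-expressions: `flat(X) = {X}` and
`flat(h(se₁, …, seₙ)) = {h(e₁, …, eₙ) | eᵢ ∈ flat(seᵢ)}`. -/
def ESExp.flat : ESExp S V → Set (PExp S V) :=
  fold (fun X => {.var X})
    fun _ h args => {e | ∃ es, e = .app h es ∧ ∀ i, es i ∈ flatUnion (args i : Set _)}

/-- Flattening of s-expressions. -/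
def SExp.flat (se : SExp S V) : Set (PExp S V) := flatUnion (ESExp.flat '' (se : Set _))

theorem ESExp.flat_var (X : V) : (ESExp.var X : ESExp S V).flat = {.var X} :=
  ESExp.fold_var _ _ X

theorem ESExp.flat_app {n : ℕ} (h : S.Sym n) (args : Fin n → SExp S V) :
    (ESExp.app h args).flat = {e | ∃ es, e = .app h es ∧ ∀ i, es i ∈ (args i).flat} := by
  refine (ESExp.fold_app _ _ h args).trans ?_
  simp only [Finset.coe_image]
  rfl

theorem SExp.flat_empty : (∅ : SExp S V).flat = {.bot} := by
  ext e
  simp [SExp.flat, flatUnion]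

theorem SExp.flat_of_nonempty {se : SExp S V} (h : se.Nonempty) :
    se.flat = ⋃ e ∈ se, e.flat := by
  ext e
  simp [SExp.flat, flatUnion, h.ne_empty]

/-- S-csubstitutions: finite mappings from variables to s-cterms (possibly `∅`). -/
structure SCSubst (S : Signature.{u}) (V : Type u) where
  toFun : V → SExp S V
  isSCTerm : ∀ X, (toFun X).IsSCTerm
  finite_dom : {X | toFun X ≠ {ESExp.var X}}.Finite

/-! ### The proof calculus -/

/-- `Derives P se st` means that `se → st` is derivable in the calculus under the program `P`. -/
inductive Derives (P : Program S V) : SExp S V → SExp S V → Prop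
  | E (se : SExp S V) : Derives P se ∅
  | RR (X : V) : Derives P {ESExp.var X} {ESExp.var X}
  | DC {n : ℕ} (c : S.Con n) (se st : Fin n → SExp S V) :
      (∀ i, Derives P (se i) (st i)) →
      Derives P {ESExp.app (.inl c) se} {ESExp.app (.inl c) st}
  | More {n : ℕ} (se : SExp S V) (st : Fin n → SExp S V) :
      (∀ i, Derives P se (st i)) → Derives P se (Finset.univ.biUnion st)
  | Less {m : ℕ} (se : SExp S V) (esa : Fin m → ESExp S V) (st : Fin m → SExp S V) :
      2 ≤ se.card → 0 < m → (∀ j, esa j ∈ se) → (∀ j, Derives P {esa j} (st j)) →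
      Derives P se (Finset.univ.biUnion st)
  | ROR (R : Rule S V) (θ : SCSubst S V) (se : Fin R.arity → SExp S V) (st : SExp S V) :
      R ∈ P.rules → (∀ i, Derives P (se i) ((R.pats i).toSExp.subst θ.toFun)) →
      Derives P (R.rhs.toSExp.subst θ.toFun) st →
      Derives P {ESExp.app (.inr R.head) se} st

/-- The denotation of an s-expression: the set of the s-cterms `st` with `se → st`. -/
def den (P : Program S V) (se : SExp S V) : Set (SExp S V) :=
  {st | st.IsSCTerm ∧ Derives P se st}

end SCalc

end

open SCalc

namespace SCalc

variable {S : Signature.{u}} {V : Type u} {P : Program S V}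

/-! ### Total expressions and shells -/

/-! Soundness and completeness rest on two separate invariants.

Soundness. A finite set of alternatives is represented by one total expression that can be rewritten
towards each of them: this is `Covers`. Derivability preserves covering (`Derives.covers`): if `e`
covers every element of `se` and `se` derives `st`, then `e` covers every element of `st`. In the
rule ROR the arguments of the call cover the instantiated patterns, and since patterns are linear
c-terms, the arguments rewrite to an honest instance of them. Extra variables receive nested
`?`-expressions that cover their values (`exists_covers`). Finally, an expression that covers an
s-cterm reaches each of its flattenings, up to `⊑` on shells.

Completeness. Derivations are pulled back along rewriting. For a step from `lσ` to `rσ`,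
`Derives.exists_subst` splits a derivation from `rσ` into evaluations of the values `σ X` to
s-cterms `θ X`, and a derivation from `rθ`. Different copies of `X` may evaluate differently, and
the union of the results serves them all; this is where set-valued substitutions are essential. ROR
with `θ` then gives the derivation from `lσ` (`Derives.of_rule`). Contexts are harmless by
`Derives.app_mono`, and every expression derives its own shell. -/

theorem Ctx.isTotal_of_isTotal_fill {C : Ctx S V} {e : PExp S V} (h : (C.fill e).IsTotal) :
    e.IsTotal := by
  induction C with
  | hole => exact h
  | app f i es C ih =>
    have := h i
    rw [Function.update_self] at this
    exact ih this

theorem Ctx.IsTotal.fill {C : Ctx S V} (hC : C.IsTotal) {e : PExp S V} (he : e.IsTotal) :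
    (C.fill e).IsTotal := by
  induction C with
  | hole => exact he
  | app f i es C ih =>
    intro j
    by_cases hj : j = i
    · subst hj
      rw [Function.update_self]
      exact ih hC.2
    · rw [Function.update_of_ne hj]
      exact hC.1 j hj

theorem PExp.IsTotal.subst {e : PExp S V} (he : e.IsTotal) {σ : V → PExp S V}
    (hσ : ∀ X, (σ X).IsTotal) : (e.subst σ).IsTotal := by
  induction e with
  | bot => exact he
  | var X => exact hσ X
  | app f args ih => exact fun i => ih i (he i)

/-- Going up in `⊑` only fills in occurrences of `⊥`. This turns approximation into equality when
`t` is total. -/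
theorem Approx.eq_of_isTotal {a b : PExp S V} (h : Approx a b) (ha : a.IsTotal) : a = b := by
  induction h with
  | refl => rfl
  | trans _ _ ih₁ ih₂ =>
    obtain rfl := ih₁ ha
    exact ih₂ ha
  | bot => exact ha.elim
  | ctx C _ ih => rw [ih (Ctx.isTotal_of_isTotal_fill ha)]

theorem Approx.app {n : ℕ} (h : S.Sym n) {es es' : Fin n → PExp S V}
    (H : ∀ i, Approx (es i) (es' i)) : Approx (.app h es) (.app h es') := by
  classical
  -- Contexts have one hole, so the arguments are replaced one at a time; `s` is the set of
  -- positions already done.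
  have key : ∀ s : Finset (Fin n), Approx (.app h es) (.app h (s.piecewise es' es)) := by
    intro s
    induction s using Finset.induction_on with
    | empty => simpa using Approx.refl _
    | insert j s hj ih =>
      refine ih.trans ?_
      have h₁ := Approx.ctx (Ctx.app h j (s.piecewise es' es) .hole) (H j)
      simp only [Ctx.fill] at h₁
      rw [← Finset.piecewise_insert] at h₁
      convert h₁ using 2
      rw [eq_comm, Function.update_eq_self_iff]
      simp [hj]
  simpa using key Finset.univ

theorem PExp.eq_of_isTotal_shell {e : PExp S V} (h : e.shell.IsTotal) : e.shell = e := by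
  induction e with
  | bot => rfl
  | var X => rfl
  | app f args ih =>
    rcases f with c | f
    · simp only [shell] at h ⊢
      exact congrArg _ (funext fun i => ih i (h i))
    · exact h.elim

theorem PExp.IsCTerm.shell_eq {e : PExp S V} (h : e.IsCTerm) : e.shell = e := by
  induction e with
  | bot => rfl
  | var X => rfl
  | app f args ih =>
    rcases f with c | f
    · simp only [shell]
      exact congrArg _ (funext fun i => ih i (h i))
    · exact h.elim

theorem PExp.isSCTerm_toSExp_shell (e : PExp S V) : e.shell.toSExp.IsSCTerm := by
  induction e with
  | bot => simp [shell, toSExp, SExp.IsSCTerm]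
  | var X =>
    intro a ha
    obtain rfl := Finset.mem_singleton.1 ha
    exact .var X
  | app f args ih =>
    rcases f with c | f
    · intro a ha
      obtain rfl := Finset.mem_singleton.1 ha
      exact .con c _ ih
    · simp [shell, toSExp, SExp.IsSCTerm]

theorem SExp.IsSCTerm.biUnion {ι : Type*} {s : Finset ι} {st : ι → SExp S V}
    (h : ∀ i ∈ s, (st i).IsSCTerm) : SExp.IsSCTerm (s.biUnion st) := by
  intro a ha
  obtain ⟨i, hi, ha⟩ := Finset.mem_biUnion.1 ha
  exact h i hi a ha

theorem PExp.mem_flat_toSExp (e : PExp S V) : e ∈ e.toSExp.flat := by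
  induction e with
  | bot => simp [toSExp, SExp.flat_empty]
  | var X =>
    simp [toSExp, SExp.flat_of_nonempty, ESExp.flat_var]
  | app f args ih =>
    simp only [toSExp, SExp.flat_of_nonempty (Finset.singleton_nonempty _), Finset.mem_singleton,
      Set.iUnion_iUnion_eq_left, ESExp.flat_app]
    exact ⟨args, rfl, ih⟩

theorem PExp.toSExp_subst (σ : V → PExp S V) (e : PExp S V) :
    (e.subst σ).toSExp = e.toSExp.subst fun X => (σ X).toSExp := by
  induction e with
  | bot => simp [toSExp, subst, SExp.subst]
  | var X => simp [toSExp, subst, SExp.subst, ESExp.subst_var]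
  | app f args ih => simp [toSExp, subst, SExp.subst, ESExp.subst_app, ih]

theorem PExp.toSExp_var_subst (θ : V → SExp S V) (X : V) :
    (PExp.var X : PExp S V).toSExp.subst θ = θ X := by
  simp [toSExp, SExp.subst, ESExp.subst_var]

theorem PExp.toSExp_app_subst (θ : V → SExp S V) {n : ℕ} (h : S.Sym n) (args : Fin n → PExp S V) :
    (PExp.app h args).toSExp.subst θ = {ESExp.app h fun i => (args i).toSExp.subst θ} := by
  simp [toSExp, SExp.subst, ESExp.subst_app]

/-! ### Rewriting -/

theorem Step.isTotal {e e' : PExp S V} (h : Step P e e') : e'.IsTotal := by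
  obtain ⟨C, R, σ, hC, hR, -, rfl⟩ := h
  exact hC.fill ((P.isCRule R hR).rhs_total.subst σ.total)

theorem Rewrites.isTotal {e e' : PExp S V} (h : Rewrites P e e') (he : e.IsTotal) :
    e'.IsTotal := by
  induction h with
  | refl => exact he
  | tail _ h _ => exact h.isTotal

theorem Step.app_update {n : ℕ} (h : S.Sym n) (i : Fin n) {es : Fin n → PExp S V}
    (hes : ∀ j, (es j).IsTotal) {a b : PExp S V} (H : Step P a b) :
    Step P (.app h (Function.update es i a)) (.app h (Function.update es i b)) := by
  obtain ⟨C, R, σ, hC, hR, rfl, rfl⟩ := H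
  exact ⟨.app h i es C, R, σ, ⟨fun j _ => hes j, hC⟩, hR, rfl, rfl⟩

theorem Rewrites.app {n : ℕ} (h : S.Sym n) {es es' : Fin n → PExp S V}
    (hes : ∀ i, (es i).IsTotal) (H : ∀ i, Rewrites P (es i) (es' i)) :
    Rewrites P (.app h es) (.app h es') := by
  classical
  have hes' : ∀ i, (es' i).IsTotal := fun i => (H i).isTotal (hes i)
  have key : ∀ s : Finset (Fin n), Rewrites P (.app h es) (.app h (s.piecewise es' es)) := by
    intro s
    induction s using Finset.induction_on with
    | empty =>
      rw [Finset.piecewise_empty]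
      exact .refl
    | insert j s hj ih =>
      refine ih.trans ?_
      have ht : ∀ i, (s.piecewise es' es i).IsTotal := by
        intro i
        by_cases hi : i ∈ s
        · simpa [hi] using hes' i
        · simpa [hi] using hes i
      have h₁ : Rewrites P (.app h (Function.update (s.piecewise es' es) j (es j)))
          (.app h (Function.update (s.piecewise es' es) j (es' j))) :=
        Relation.ReflTransGen.lift
          (fun a => PExp.app h (Function.update (s.piecewise es' es) j a))
          (fun a b hab => Step.app_update h j ht hab) _ _ (H j)
      have h₂ : Function.update (s.piecewise es' es) j (es j) = s.piecewise es' es :=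
        Function.update_eq_self_iff.2 (by simp [hj])
      rw [← Finset.piecewise_insert, h₂] at h₁
      exact h₁
  simpa using key Finset.univ

theorem Program.rewrites_rule {R : Rule S V} (hR : R ∈ P.rules) (σ : Subst S V) :
    Rewrites P (R.lhs.subst σ.toFun) (R.rhs.subst σ.toFun) :=
  .single ⟨.hole, R, σ, trivial, hR, rfl, rfl⟩

theorem Program.rewrites_choice (P : Program S V) {e₁ e₂ : PExp S V} (h₁ : e₁.IsTotal)
    (h₂ : e₂.IsTotal) :
    Rewrites P (.app (.inr S.choice) ![e₁, e₂]) e₁ ∧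
      Rewrites P (.app (.inr S.choice) ![e₁, e₂]) e₂ := by
  classical
  obtain ⟨X, Y, hXY, hP⟩ := P.choice_rules
  have hX : choiceRule X Y X ∈ P.rules :=
    (hP.symm.subset (Set.mem_insert _ _)).1
  have hY : choiceRule X Y Y ∈ P.rules :=
    (hP.symm.subset (Set.mem_insert_of_mem _ rfl)).1
  let σ : Subst S V :=
    { toFun := fun Z => if Z = X then e₁ else if Z = Y then e₂ else .var Z
      total := by
        intro Z
        split_ifs
        exacts [h₁, h₂, trivial]
      finite_dom := by
        refine (Set.toFinite {X, Y}).subset fun Z hZ => ?_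
        by_contra hc
        simp only [Set.mem_insert_iff, Set.mem_singleton_iff, not_or] at hc
        simp [hc.1, hc.2] at hZ }
  have hσX : σ.toFun X = e₁ := by simp [σ]
  have hσY : σ.toFun Y = e₂ := by simp [σ, hXY.symm]
  have hl : ∀ Z, (choiceRule X Y Z).lhs.subst σ.toFun =
      (.app (.inr S.choice) ![e₁, e₂] : PExp S V) := by
    intro Z
    simp only [Rule.lhs, choiceRule, PExp.subst]
    congr 1
    funext i
    fin_cases i <;> simp [PExp.subst, hσX, hσY]
  have h₁ := P.rewrites_rule hX σ
  have h₂ := P.rewrites_rule hY σ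
  rw [hl] at h₁ h₂
  exact ⟨by simpa [choiceRule, PExp.subst, hσX] using h₁,
    by simpa [choiceRule, PExp.subst, hσY] using h₂⟩

/-! ### Soundness -/

/-- `e` covers `a` if it rewrites to an expression with the root symbol of `a` whose arguments
cover all the elements of the corresponding arguments of `a`. -/
inductive Covers (P : Program S V) : PExp S V → ESExp S V → Prop
  | var {e : PExp S V} (X : V) : Rewrites P e (.var X) → Covers P e (ESExp.var X)
  | app {e : PExp S V} {n : ℕ} (h : S.Sym n) (es : Fin n → PExp S V) (args : Fin n → SExp S V) :
      Rewrites P e (.app h es) → (∀ i, (es i).IsTotal) →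
      (∀ i, ∀ a ∈ args i, Covers P (es i) a) → Covers P e (ESExp.app h args)

theorem Covers.app_inv {e : PExp S V} {n : ℕ} {h : S.Sym n} {args : Fin n → SExp S V}
    (H : Covers P e (ESExp.app h args)) :
    ∃ es : Fin n → PExp S V, Rewrites P e (.app h es) ∧ (∀ i, (es i).IsTotal) ∧
      ∀ i, ∀ a ∈ args i, Covers P (es i) a := by
  generalize ha : ESExp.app h args = a at H
  cases H with
  | var X _ => exact absurd ha.symm (ESExp.var_ne_app X h args)
  | app h' es args' h₁ h₂ h₃ =>
    obtain rfl := ESExp.app_inj_arity ha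
    obtain ⟨rfl, rfl⟩ := ESExp.app_inj ha
    exact ⟨es, h₁, h₂, h₃⟩

theorem Covers.of_rewrites {e e' : PExp S V} {a : ESExp S V} (H : Covers P e' a)
    (h : Rewrites P e e') : Covers P e a := by
  cases H with
  | var X h₁ => exact .var X (h.trans h₁)
  | app f es args h₁ h₂ h₃ => exact .app f es args (h.trans h₁) h₂ h₃

/-- All occurrences of `X` become the same expression `σ X`, which is enough because `σ X` covers
the whole set `θ X` at once. -/
theorem Covers.subst {σ : V → PExp S V} {θ : V → SExp S V} (hσ : ∀ X, (σ X).IsTotal)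
    (H : ∀ X, ∀ a ∈ θ X, Covers P (σ X) a) {e : PExp S V} (he : e.IsTotal) :
    ∀ a ∈ e.toSExp.subst θ, Covers P (e.subst σ) a := by
  induction e with
  | bot => exact he.elim
  | var X =>
    rw [PExp.toSExp_var_subst]
    exact H X
  | app f args ih =>
    rw [PExp.toSExp_app_subst]
    intro a ha
    obtain rfl := Finset.mem_singleton.1 ha
    exact .app f _ _ .refl (fun i => (he i).subst hσ) fun i => ih i (he i)

theorem covers_toSExp {e : PExp S V} (he : e.IsTotal) : ∀ a ∈ e.toSExp, Covers P e a := by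
  induction e with
  | bot => exact he.elim
  | var X =>
    intro a ha
    obtain rfl := Finset.mem_singleton.1 ha
    exact .var X .refl
  | app f args ih =>
    intro a ha
    obtain rfl := Finset.mem_singleton.1 ha
    exact .app f args _ .refl he fun i => ih i (he i)

/-- Covers of the single elements are joined by nested `?`, from which each of them can be reached.
-/
theorem exists_covers_of_forall (se : SExp S V)
    (h : ∀ a ∈ se, ∃ e : PExp S V, e.IsTotal ∧ Covers P e a) :
    ∃ e : PExp S V, e.IsTotal ∧ ∀ a ∈ se, Covers P e a := by
  induction se using Finset.induction_on with
  | empty =>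
    -- Any total expression covers the empty set; a variable exists because the rules for `?`
    -- contain one.
    obtain ⟨X, -⟩ := P.choice_rules
    exact ⟨.var X, trivial, by simp⟩
  | insert a se _ ih =>
    obtain ⟨e₁, ht₁, h₁⟩ := h a (Finset.mem_insert_self _ _)
    obtain ⟨e₂, ht₂, h₂⟩ := ih fun b hb => h b (Finset.mem_insert_of_mem hb)
    obtain ⟨hc₁, hc₂⟩ := P.rewrites_choice ht₁ ht₂
    refine ⟨.app (.inr S.choice) ![e₁, e₂], ?_, ?_⟩
    · intro i
      fin_cases i
      exacts [ht₁, ht₂]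
    · intro b hb
      rcases Finset.mem_insert.1 hb with rfl | hb
      · exact h₁.of_rewrites hc₁
      · exact (h₂ b hb).of_rewrites hc₂

theorem exists_covers_elem (P : Program S V) (a : ESExp S V) :
    ∃ e : PExp S V, e.IsTotal ∧ Covers P e a := by
  induction a using ESExp.induction with
  | hvar X => exact ⟨.var X, trivial, .var X .refl⟩
  | happ h args ih =>
    choose es ht hc using fun i => exists_covers_of_forall (args i) (ih i)
    exact ⟨.app h es, ht, .app h es args .refl ht hc⟩

theorem exists_covers (P : Program S V) (se : SExp S V) :
    ∃ e : PExp S V, e.IsTotal ∧ ∀ a ∈ se, Covers P e a :=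
  exists_covers_of_forall se fun a _ => exists_covers_elem P a

/-! ### Matching linear patterns -/

theorem PExp.subst_congr {σ τ : V → PExp S V} {e : PExp S V}
    (h : ∀ X, e.occ X ≠ 0 → σ X = τ X) : e.subst σ = e.subst τ := by
  induction e with
  | bot => rfl
  | var X => exact h X (by simp [occ])
  | app f args ih =>
    simp only [subst]
    refine congrArg _ (funext fun i => ih i fun X hX => h X ?_)
    simp only [occ]
    exact fun h0 => hX (Finset.sum_eq_zero_iff.1 h0 i (Finset.mem_univ i))

theorem PExp.finite_occ (e : PExp S V) : {X | e.occ X ≠ 0}.Finite := by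
  induction e with
  | bot => simp [occ]
  | var Y =>
    refine (Set.finite_singleton Y).subset fun X hX => ?_
    by_contra hc
    exact hX (by simpa [occ] using hc)
  | app f args ih =>
    refine (Set.finite_iUnion ih).subset fun X hX => ?_
    obtain ⟨i, _, hi⟩ := Finset.exists_ne_zero_of_sum_ne_zero hX
    exact Set.mem_iUnion.2 ⟨i, hi⟩

/-- Combining substitutions for the members of a tuple in which no variable occurs twice. -/
theorem exists_subst_of_linear {n : ℕ} {ps : Fin n → PExp S V}
    (hlin : ∀ X, ∑ i, (ps i).occ X ≤ 1) (σ : Fin n → V → PExp S V) :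
    ∃ τ : V → PExp S V, ∀ i X, (ps i).occ X ≠ 0 → τ X = σ i X := by
  classical
  refine ⟨fun X => if h : ∃ i, (ps i).occ X ≠ 0 then σ h.choose X else .var X, ?_⟩
  intro i X hi
  have h : ∃ i, (ps i).occ X ≠ 0 := ⟨i, hi⟩
  simp only [dif_pos h]
  have hc := h.choose_spec
  set j := h.choose
  suffices j = i by rw [this]
  -- Two different positions containing `X` would contribute at least 2 to the sum.
  by_contra hne
  have h₁ : ∑ k ∈ {j, i}, (ps k).occ X ≤ ∑ k, (ps k).occ X :=
    Finset.sum_le_sum_of_subset (Finset.subset_univ _)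
  rw [Finset.sum_pair hne] at h₁
  have := hlin X
  omega

theorem exists_subst_of_covers_tuple {n : ℕ} {ps es : Fin n → PExp S V} {θ : V → SExp S V}
    (hlin : ∀ X, ∑ i, (ps i).occ X ≤ 1)
    (h : ∀ i, ∃ σ : V → PExp S V, Rewrites P (es i) ((ps i).subst σ) ∧
      ∀ X, (ps i).occ X ≠ 0 → (σ X).IsTotal ∧ ∀ a ∈ θ X, Covers P (σ X) a) :
    ∃ σ : V → PExp S V, (∀ i, Rewrites P (es i) ((ps i).subst σ)) ∧
      ∀ i X, (ps i).occ X ≠ 0 → (σ X).IsTotal ∧ ∀ a ∈ θ X, Covers P (σ X) a := by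
  choose σ h₁ h₂ using h
  obtain ⟨τ, hτ⟩ := exists_subst_of_linear hlin σ
  refine ⟨τ, fun i => ?_, fun i X hX => ?_⟩
  · rw [PExp.subst_congr (hτ i)]
    exact h₁ i
  · rw [hτ i X hX]
    exact h₂ i X hX

/-- A constructor at the root of `p` forces `e` to rewrite to that constructor with covering
arguments, so matching descends through `p`. At a variable, whatever expression has been reached is
the value. Linearity makes the values found in different arguments compatible. -/
theorem exists_subst_of_covers {p : PExp S V} (hc : p.IsCTerm) (ht : p.IsTotal)
    (hlin : ∀ X, p.occ X ≤ 1) {θ : V → SExp S V} {e : PExp S V} (he : e.IsTotal)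
    (H : ∀ a ∈ p.toSExp.subst θ, Covers P e a) :
    ∃ σ : V → PExp S V, Rewrites P e (p.subst σ) ∧
      ∀ X, p.occ X ≠ 0 → (σ X).IsTotal ∧ ∀ a ∈ θ X, Covers P (σ X) a := by
  induction p generalizing e with
  | bot => exact ht.elim
  | var X =>
    rw [PExp.toSExp_var_subst] at H
    refine ⟨fun _ => e, .refl, fun Y hY => ?_⟩
    obtain rfl : Y = X := by
      by_contra hne
      simp [PExp.occ, hne] at hY
    exact ⟨he, H⟩
  | app f ps ih =>
    rcases f with c | f
    · rw [PExp.toSExp_app_subst] at H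
      obtain ⟨es, h₁, h₂, h₃⟩ := (H _ (Finset.mem_singleton_self _)).app_inv
      obtain ⟨σ, hσ₁, hσ₂⟩ := exists_subst_of_covers_tuple (P := P) (es := es) (θ := θ) hlin
        fun i => ih i (hc i) (ht i)
          (fun X => (Finset.single_le_sum (f := fun i => (ps i).occ X) (fun _ _ => Nat.zero_le _)
            (Finset.mem_univ i)).trans (hlin X)) (h₂ i) (h₃ i)
      refine ⟨σ, h₁.trans (Rewrites.app _ h₂ hσ₁), fun X hX => ?_⟩
      obtain ⟨i, _, hi⟩ := Finset.exists_ne_zero_of_sum_ne_zero hX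
      exact hσ₂ i X hi
    · exact hc.elim

/-- A rule whose left-hand side covers an instance under an s-csubstitution can be applied. -/
theorem exists_rewrites_rhs {R : Rule S V} (hR : R ∈ P.rules) (θ : SCSubst S V)
    {es : Fin R.arity → PExp S V} (hes : ∀ i, (es i).IsTotal)
    (H : ∀ i, ∀ a ∈ (R.pats i).toSExp.subst θ.toFun, Covers P (es i) a) :
    ∃ e : PExp S V, Rewrites P (.app (.inr R.head) es) e ∧
      ∀ a ∈ R.rhs.toSExp.subst θ.toFun, Covers P e a := by
  classical
  have hr := P.isCRule R hR
  obtain ⟨σ, hσ₁, hσ₂⟩ := exists_subst_of_covers_tuple (P := P) (es := es) (θ := θ.toFun) hr.linear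
    fun i => exists_subst_of_covers (hr.pats_cterm i) (hr.pats_total i)
      (fun X => (Finset.single_le_sum (f := fun i => (R.pats i).occ X) (fun _ _ => Nat.zero_le _)
            (Finset.mem_univ i)).trans (hr.linear X)) (hes i) (H i)
  choose g hg₁ hg₂ using fun X => exists_covers P (θ.toFun X)
  -- Pattern variables take the values found by matching and extra variables take covers of their
  -- values. The middle case, which fixes `X` when `θ` does, keeps the domain finite.
  let τ : V → PExp S V := fun X =>
    if ∃ i, (R.pats i).occ X ≠ 0 then σ X
    else if θ.toFun X = {ESExp.var X} then .var X else g X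
  have hτ : ∀ X, (τ X).IsTotal ∧ ∀ a ∈ θ.toFun X, Covers P (τ X) a := by
    intro X
    simp only [τ]
    split_ifs with h₁ h₂
    · obtain ⟨i, hi⟩ := h₁
      exact hσ₂ i X hi
    · refine ⟨trivial, fun a ha => ?_⟩
      rw [h₂] at ha
      obtain rfl := Finset.mem_singleton.1 ha
      exact .var X .refl
    · exact ⟨hg₁ X, hg₂ X⟩
  let τ' : Subst S V :=
    { toFun := τ
      total := fun X => (hτ X).1
      finite_dom := by
        refine ((Set.finite_iUnion fun i => (R.pats i).finite_occ).union θ.finite_dom).subset ?_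
        intro X hX
        by_contra hc
        simp only [Set.mem_union, Set.mem_iUnion, Set.mem_ofPred_eq, not_or, not_not] at hc
        exact hX (by simp only [τ]; rw [if_neg hc.1, if_pos hc.2]) }
  refine ⟨R.rhs.subst τ, .trans ?_ (P.rewrites_rule hR τ'),
    Covers.subst (fun X => (hτ X).1) (fun X => (hτ X).2) hr.rhs_total⟩
  refine Rewrites.app _ hes fun i => ?_
  have : (R.pats i).subst τ = (R.pats i).subst σ :=
    PExp.subst_congr fun X hX => if_pos ⟨i, hX⟩
  change Rewrites P (es i) ((R.pats i).subst τ)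
  rw [this]
  exact hσ₁ i

/-- The soundness invariant. It must hold for all `e` covering `se`, since in ROR the induction
hypothesis is applied to the arguments of the call and then to the instance of the right-hand side.
-/
theorem Derives.covers {se st : SExp S V} (H : Derives P se st) {e : PExp S V}
    (he : ∀ a ∈ se, Covers P e a) : ∀ a ∈ st, Covers P e a := by
  induction H generalizing e with
  | E se => simp
  | RR X => exact he
  | DC c se st _ ih =>
    obtain ⟨es, h₁, h₂, h₃⟩ := (he _ (Finset.mem_singleton_self _)).app_inv
    intro a ha
    obtain rfl := Finset.mem_singleton.1 ha
    exact .app _ es _ h₁ h₂ fun i => ih i (h₃ i)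
  | More se st _ ih =>
    intro a ha
    obtain ⟨i, -, ha⟩ := Finset.mem_biUnion.1 ha
    exact ih i he a ha
  | Less se esa st _ _ hmem _ ih =>
    intro a ha
    obtain ⟨i, -, ha⟩ := Finset.mem_biUnion.1 ha
    refine ih i (fun b hb => ?_) a ha
    obtain rfl := Finset.mem_singleton.1 hb
    exact he _ (hmem i)
  | ROR R θ se st hR _ _ ih₁ ih₂ =>
    obtain ⟨es, h₁, h₂, h₃⟩ := (he _ (Finset.mem_singleton_self _)).app_inv
    obtain ⟨e', h₄, h₅⟩ := exists_rewrites_rhs hR θ h₂ fun i => ih₁ i (h₃ i)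
    exact fun a ha => (ih₂ h₅ a ha).of_rewrites (h₁.trans h₄)

/-- A flattening commits to one element of `st`, or to `⊥` if there is none, and the same `e` covers
all the elements. The hypothesis `H` is shaped as the induction hypothesis of
`Covers.exists_rewrites`. -/
theorem exists_rewrites_of_forall_covers {st : SExp S V}
    (H : ∀ a ∈ st, ∀ e t : PExp S V, Covers P e a → t ∈ a.flat →
      ∃ e' : PExp S V, Rewrites P e e' ∧ Approx t e'.shell)
    {e t : PExp S V} (he : ∀ a ∈ st, Covers P e a) (ht : t ∈ st.flat) :
    ∃ e' : PExp S V, Rewrites P e e' ∧ Approx t e'.shell := by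
  rcases st.eq_empty_or_nonempty with rfl | hne
  · rw [SExp.flat_empty] at ht
    obtain rfl := Set.mem_singleton_iff.1 ht
    exact ⟨e, .refl, .bot _⟩
  · rw [SExp.flat_of_nonempty hne] at ht
    obtain ⟨a, ha, hta⟩ := Set.mem_iUnion₂.1 ht
    exact H a ha e t (he a ha) hta

theorem Covers.exists_rewrites {a : ESExp S V} (ha : a.IsESCTerm) :
    ∀ e t : PExp S V, Covers P e a → t ∈ a.flat →
      ∃ e' : PExp S V, Rewrites P e e' ∧ Approx t e'.shell := by
  induction ha with
  | var X =>
    intro e t he ht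
    rw [ESExp.flat_var] at ht
    obtain rfl := Set.mem_singleton_iff.1 ht
    generalize hb : ESExp.var X = b at he
    cases he with
    | var Y h =>
      obtain rfl := ESExp.var_injective hb
      exact ⟨_, h, .refl _⟩
    | app f es args => exact absurd hb (ESExp.var_ne_app X f args)
  | con c args _ ih =>
    intro e t he ht
    rw [ESExp.flat_app] at ht
    obtain ⟨ts, rfl, hts⟩ := ht
    obtain ⟨es, h₁, h₂, h₃⟩ := he.app_inv
    choose es' h₄ h₅ using fun i => exists_rewrites_of_forall_covers (ih i) (h₃ i) (hts i)
    exact ⟨.app (.inl c) es', h₁.trans (Rewrites.app _ h₂ h₄), Approx.app _ h₅⟩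

theorem exists_rewrites_of_mem_den {e t : PExp S V} {st : SExp S V} (he : e.IsTotal)
    (hst : st ∈ den P e.toSExp) (ht : t ∈ st.flat) :
    ∃ e' : PExp S V, e'.IsTotal ∧ Rewrites P e e' ∧ Approx t e'.shell := by
  obtain ⟨e', h₁, h₂⟩ := exists_rewrites_of_forall_covers
    (fun a ha => Covers.exists_rewrites (hst.1 a ha)) (hst.2.covers (covers_toSExp he)) ht
  exact ⟨e', h₁.isTotal he, h₁, h₂⟩

/-! ### Completeness -/

/-! ### Structural properties of derivability -/

theorem Derives.isSCTerm {se st : SExp S V} (H : Derives P se st) : st.IsSCTerm := by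
  induction H with
  | E se => simp [SExp.IsSCTerm]
  | RR X =>
    intro a ha
    obtain rfl := Finset.mem_singleton.1 ha
    exact .var X
  | DC c se st _ ih =>
    intro a ha
    obtain rfl := Finset.mem_singleton.1 ha
    exact .con c _ ih
  | More se st _ ih => exact .biUnion fun i _ => ih i
  | Less se esa st _ _ _ _ ih => exact .biUnion fun i _ => ih i
  | ROR R θ se st _ _ _ _ ih => exact ih

theorem Derives.of_mem {a : ESExp S V} {se st : SExp S V} (H : Derives P {a} st) (ha : a ∈ se) :
    Derives P se st := by
  -- Less demands two elements; otherwise `se` is `{a}` itself.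
  rcases Nat.lt_or_ge se.card 2 with h | h
  · have h₁ : se.card = 1 := by
      have := Finset.card_pos.2 ⟨a, ha⟩
      omega
    obtain ⟨b, rfl⟩ := Finset.card_eq_one.1 h₁
    obtain rfl := Finset.mem_singleton.1 ha
    exact H
  · have := Derives.Less (m := 1) se (fun _ => a) (fun _ => st) h one_pos (fun _ => ha)
      fun _ => H
    simpa using this

theorem Derives.of_forall_mem {se st : SExp S V} (h : ∀ a ∈ st, Derives P se {a}) :
    Derives P se st := by
  have := Derives.More se (fun j => {((st.equivFin.symm j : st) : ESExp S V)})
    fun j => h _ (st.equivFin.symm j).2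
  convert this
  ext a
  simp only [Finset.mem_biUnion, Finset.mem_univ, true_and, Finset.mem_singleton]
  exact ⟨fun ha => ⟨st.equivFin ⟨a, ha⟩, by simp⟩,
    fun ⟨j, hj⟩ => hj ▸ (st.equivFin.symm j).2⟩

theorem Derives.refl_of_isSCTerm {st : SExp S V} (h : st.IsSCTerm) : Derives P st st := by
  have key : ∀ a : ESExp S V, a.IsESCTerm → Derives P {a} {a} := by
    intro a ha
    induction ha with
    | var X => exact .RR X
    | con c args _ ih =>
      exact .DC c _ _ fun i => .of_forall_mem fun a ha => (ih i a ha).of_mem ha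
  exact .of_forall_mem fun a ha => (key a (h a ha)).of_mem ha

theorem Derives.mono {se se' st : SExp S V} (H : Derives P se st) (hs : se ⊆ se') :
    Derives P se' st := by
  induction H with
  | E se => exact .E _
  | RR X => exact (Derives.RR X).of_mem (Finset.singleton_subset_iff.1 hs)
  | DC c se st h _ => exact (Derives.DC c se st h).of_mem (Finset.singleton_subset_iff.1 hs)
  | More se st _ ih => exact .More _ st fun i => ih i hs
  | Less se esa st hc hm hmem h _ =>
    exact .Less _ esa st (hc.trans (Finset.card_le_card hs)) hm (fun j => hs (hmem j)) h
  | ROR R θ se st hR h₁ h₂ _ _ =>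
    exact (Derives.ROR R θ se st hR h₁ h₂).of_mem (Finset.singleton_subset_iff.1 hs)

/-- DC and ROR use the arguments only through what these derive. This gives closure under contexts
as well as monotonicity in substitutions. -/
theorem Derives.app_mono {n : ℕ} {h : S.Sym n} {se se' : Fin n → SExp S V}
    (hs : ∀ i st, Derives P (se i) st → Derives P (se' i) st) {st : SExp S V}
    (H : Derives P {ESExp.app h se} st) : Derives P {ESExp.app h se'} st := by
  generalize hx : ({ESExp.app h se} : SExp S V) = x at H
  induction H with
  | E => exact .E _
  | RR X => exact absurd (Finset.singleton_injective hx).symm (ESExp.var_ne_app _ _ _)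
  | DC c se₁ st hd _ =>
    have hx := Finset.singleton_injective hx
    obtain rfl := ESExp.app_inj_arity hx
    obtain ⟨rfl, rfl⟩ := ESExp.app_inj hx
    exact .DC c _ _ fun i => hs i _ (hd i)
  | More _ st _ ih => exact .More _ st fun i => ih i hx
  | Less _ esa st hc =>
    subst hx
    simp at hc
  | ROR R θ se₁ st hR hd hd' =>
    have hx := Finset.singleton_injective hx
    obtain rfl := ESExp.app_inj_arity hx
    obtain ⟨rfl, rfl⟩ := ESExp.app_inj hx
    exact .ROR R θ _ _ hR (fun i => hs i _ (hd i)) hd'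

/-- `Derives.mono` alone does not suffice: below a symbol, enlarging `θ` changes the arguments
inside a singleton and does not enlarge the set. -/
theorem Derives.subst_mono {θ θ' : V → SExp S V} (hθ : ∀ X, θ X ⊆ θ' X) (e : PExp S V)
    {st : SExp S V} (H : Derives P (e.toSExp.subst θ) st) : Derives P (e.toSExp.subst θ') st := by
  induction e generalizing st with
  | bot => exact H
  | var X =>
    rw [PExp.toSExp_var_subst] at H ⊢
    exact H.mono (hθ X)
  | app f args ih =>
    rw [PExp.toSExp_app_subst] at H ⊢
    exact H.app_mono fun i _ => ih i

theorem Derives.subset_of_var {X : V} {st : SExp S V} (H : Derives P {ESExp.var X} st) :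
    st ⊆ {ESExp.var X} := by
  generalize hx : ({ESExp.var X} : SExp S V) = x at H
  induction H with
  | E => simp
  | RR Y => exact subset_rfl
  | DC => exact absurd (Finset.singleton_injective hx) (ESExp.var_ne_app _ _ _)
  | More _ st _ ih => exact Finset.biUnion_subset.2 fun i _ => ih i hx
  | Less _ esa st hc =>
    subst hx
    simp at hc
  | ROR => exact absurd (Finset.singleton_injective hx) (ESExp.var_ne_app _ _ _)

/-! ### Pulling derivations back along rewriting -/

/-- What an instance of `e` derives is derivable from an instance in which the variables are
replaced by s-cterms derivable from their values. -/
theorem Derives.exists_subst {σ : V → SExp S V} (e : PExp S V) {st : SExp S V}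
    (H : Derives P (e.toSExp.subst σ) st) :
    ∃ θ : V → SExp S V, (∀ X, Derives P (σ X) (θ X)) ∧ Derives P (e.toSExp.subst θ) st := by
  classical
  induction e generalizing st with
  | bot => exact ⟨fun _ => ∅, fun X => .E _, H⟩
  | var X =>
    rw [PExp.toSExp_var_subst] at H
    -- The whole result `st` becomes the value of `X`; it derives itself because derivable sets are
    -- s-cterms.
    refine ⟨fun Y => if Y = X then st else ∅, fun Y => ?_, ?_⟩
    · dsimp only
      split_ifs with h
      · exact h ▸ H
      · exact .E _
    · rw [PExp.toSExp_var_subst, if_pos rfl]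
      exact .refl_of_isSCTerm H.isSCTerm
  | app f args ih =>
    -- Finitely many substitutions are merged pointwise by union: More derives the unions, and
    -- enlarging a substitution preserves derivability.
    have union : ∀ {m : ℕ} (es : Fin m → PExp S V) (st : Fin m → SExp S V),
        (∀ i, ∃ θ : V → SExp S V, (∀ X, Derives P (σ X) (θ X)) ∧
          Derives P ((es i).toSExp.subst θ) (st i)) →
        ∃ θ : V → SExp S V, (∀ X, Derives P (σ X) (θ X)) ∧
          ∀ i, Derives P ((es i).toSExp.subst θ) (st i) := by
      intro m es st h
      choose θ h₁ h₂ using h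
      exact ⟨fun X => Finset.univ.biUnion fun i => θ i X, fun X => .More _ _ fun i => h₁ i X,
        fun i => (h₂ i).subst_mono fun X =>
          Finset.subset_biUnion_of_mem (fun i => θ i X) (Finset.mem_univ i)⟩
    generalize hx : (PExp.app f args).toSExp.subst σ = x at H
    induction H with
    | E => exact ⟨fun _ => ∅, fun X => .E _, .E _⟩
    | RR X =>
      rw [PExp.toSExp_app_subst] at hx
      exact absurd (Finset.singleton_injective hx).symm (ESExp.var_ne_app _ _ _)
    | DC c se st hd _ =>
      rw [PExp.toSExp_app_subst] at hx
      have hx := Finset.singleton_injective hx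
      obtain rfl := ESExp.app_inj_arity hx
      obtain ⟨rfl, rfl⟩ := ESExp.app_inj hx
      obtain ⟨θ, h₁, h₂⟩ := union args st fun i => ih i (hd i)
      refine ⟨θ, h₁, ?_⟩
      rw [PExp.toSExp_app_subst]
      exact .DC c _ _ h₂
    | More _ st _ ih' =>
      -- More evaluates the same expression several times, so the merge is over copies of it.
      obtain ⟨θ, h₁, h₂⟩ := union (fun _ => PExp.app f args) st fun i => ih' i hx
      exact ⟨θ, h₁, .More _ _ h₂⟩
    | Less _ esa st hc =>
      rw [← hx, PExp.toSExp_app_subst] at hc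
      simp at hc
    | ROR R θ' se st hR hd hd' =>
      rw [PExp.toSExp_app_subst] at hx
      have hx := Finset.singleton_injective hx
      obtain rfl := ESExp.app_inj_arity hx
      obtain ⟨rfl, rfl⟩ := ESExp.app_inj hx
      -- Only the evaluation of the arguments involves `σ`; the derivation from the right-hand side
      -- of the rule is reused unchanged.
      obtain ⟨θ, h₁, h₂⟩ := union args _ fun i => ih i (hd i)
      refine ⟨θ, h₁, ?_⟩
      rw [PExp.toSExp_app_subst]
      exact .ROR R θ' _ _ hR h₂ hd'

/-- Without function symbols, DC carries the evaluation of the variables up to the root. -/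
theorem Derives.subst_cterm {σ θ : V → SExp S V} (h : ∀ X, Derives P (σ X) (θ X)) {p : PExp S V}
    (hp : p.IsCTerm) : Derives P (p.toSExp.subst σ) (p.toSExp.subst θ) := by
  induction p with
  | bot => exact .E _
  | var X =>
    simp only [PExp.toSExp_var_subst]
    exact h X
  | app f args ih =>
    rcases f with c | f
    · simp only [PExp.toSExp_app_subst]
      exact .DC c _ _ fun i => ih i (hp i)
    · exact hp.elim

theorem Derives.of_rule {R : Rule S V} (hR : R ∈ P.rules) (σ : Subst S V) {st : SExp S V}
    (H : Derives P (R.rhs.subst σ.toFun).toSExp st) :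
    Derives P (R.lhs.subst σ.toFun).toSExp st := by
  classical
  rw [PExp.toSExp_subst] at H ⊢
  obtain ⟨θ, h₁, h₂⟩ := H.exists_subst
  -- `θ` may shrink `{X}` to `∅` at infinitely many `X`. Restoring `{X}` wherever `σ` fixes `X`
  -- gives a finite domain, and it only enlarges `θ`, since a variable derives nothing beyond
  -- itself.
  let τ : V → SExp S V := fun X => if σ.toFun X = .var X then {ESExp.var X} else θ X
  have hτ : ∀ X, Derives P (σ.toFun X).toSExp (τ X) := by
    intro X
    simp only [τ]
    split_ifs with h
    · rw [h]
      exact .RR X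
    · exact h₁ X
  have hle : ∀ X, θ X ⊆ τ X := by
    intro X
    simp only [τ]
    split_ifs with h
    · have := h₁ X
      rw [h] at this
      exact this.subset_of_var
    · exact subset_rfl
  let θ' : SCSubst S V :=
    { toFun := τ
      isSCTerm := fun X => (hτ X).isSCTerm
      finite_dom := σ.finite_dom.subset fun X hX h => hX (if_pos h) }
  rw [Rule.lhs, PExp.toSExp_app_subst]
  exact .ROR R θ' _ _ hR (fun i => Derives.subst_cterm hτ ((P.isCRule R hR).pats_cterm i))
    (h₂.subst_mono hle)

theorem Derives.fill {e e' : PExp S V} (h : ∀ st, Derives P e'.toSExp st → Derives P e.toSExp st)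
    (C : Ctx S V) {st : SExp S V} (H : Derives P (C.fill e').toSExp st) :
    Derives P (C.fill e).toSExp st := by
  induction C generalizing st with
  | hole => exact h st H
  | app f i es C ih =>
    refine Derives.app_mono (fun j st' hj => ?_) H
    by_cases hji : j = i
    · subst hji
      rw [Function.update_self] at hj ⊢
      exact ih hj
    · rw [Function.update_of_ne hji] at hj ⊢
      exact hj

theorem Derives.of_rewrites {e e' : PExp S V} (h : Rewrites P e e') {st : SExp S V}
    (H : Derives P e'.toSExp st) : Derives P e.toSExp st := by
  induction h with
  | refl => exact H
  | tail _ hs ih =>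
    obtain ⟨C, R, σ, -, hR, rfl, rfl⟩ := hs
    exact ih (H.fill (fun _ => Derives.of_rule hR σ) C)

theorem derives_shell (e : PExp S V) : Derives P e.toSExp e.shell.toSExp := by
  induction e with
  | bot => exact .E _
  | var X => exact .RR X
  | app f args ih =>
    rcases f with c | f
    · exact .DC c _ _ ih
    · exact .E _

theorem Rewrites.shell_mem_den {e e' : PExp S V} (h : Rewrites P e e') :
    e'.shell.toSExp ∈ den P e.toSExp :=
  ⟨e'.isSCTerm_toSExp_shell, (derives_shell e').of_rewrites h⟩

end SCalc

theorem mainTheorem2 {S : Signature.{u}} {V : Type u} (P : Program S V) :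
    -- Soundness
    (∀ e t : PExp S V, ∀ st : SExp S V, e.IsTotal → t.IsCTerm → st.IsSCTerm →
      (st ∈ den P e.toSExp → t ∈ st.flat →
        ∃ e' : PExp S V, e'.IsTotal ∧ Rewrites P e e' ∧ Approx t e'.shell) ∧
      (t.toSExp ∈ den P e.toSExp →
        ∃ e' : PExp S V, e'.IsTotal ∧ Rewrites P e e' ∧ Approx t e'.shell) ∧
      (t.IsTotal → ((st ∈ den P e.toSExp ∧ t ∈ st.flat) ∨ t.toSExp ∈ den P e.toSExp) →
        Rewrites P e t)) ∧
    -- Completeness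
    (∀ e e' : PExp S V, e.IsTotal → e'.IsTotal → Rewrites P e e' →
      e'.shell.toSExp ∈ den P e.toSExp) ∧
    (∀ e t : PExp S V, e.IsTotal → t.IsCTerm → t.IsTotal → Rewrites P e t →
      t.toSExp ∈ den P e.toSExp) := by
  have sound : ∀ e t : PExp S V, ∀ st : SExp S V, e.IsTotal → st ∈ den P e.toSExp → t ∈ st.flat →
      t.IsTotal → Rewrites P e t := by
    intro e t st he hst ht htot
    obtain ⟨e', -, h₁, h₂⟩ := exists_rewrites_of_mem_den he hst ht
    have h₃ := h₂.eq_of_isTotal htot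
    -- Here `t` is the shell of `e'`; a total shell has lost nothing, so it is `e'` itself.
    rw [PExp.eq_of_isTotal_shell (h₃ ▸ htot)] at h₃
    exact h₃ ▸ h₁
  refine ⟨fun e t st he _ _ => ⟨fun hst ht => exists_rewrites_of_mem_den he hst ht,
    fun ht => exists_rewrites_of_mem_den he ht t.mem_flat_toSExp, fun htot h => ?_⟩,
    fun e e' _ _ h => h.shell_mem_den, fun e t _ ht _ h => ?_⟩
  · rcases h with ⟨hst, ht⟩ | ht
    · exact sound e t st he hst ht htot
    · exact sound e t _ he ht t.mem_flat_toSExp htot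
  · have := h.shell_mem_den
    rwa [ht.shell_eq] at this
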